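/- **Theorem 3.2.** Let $1\le r\le k$ be integers, let $F$ be a finitely generated field extension of transcendence degree one of a finite field $\mathbb{F}_q$, and let $P_\infty$ be a rational place of $F$. Here a place $P$ is a normalized discrete valuation $v_P:F\to\mathbb{Z}\cup\{\infty\}$ trivial on $\mathbb{F}_q$, and it is rational if its residue field is $\mathbb{F}_q$; for a function $f$ with $v_P(f)\ge 0$, $f(P)\in\mathbb{F}_q$ denotes its image in the residue field of a rational place $P$. Let $g$ be the genus of $F$, and let $S$ be the set of rational places of $F$ other than $P_\infty$. For $i\in\{1,\dots,r\}$ and $j\in\{1,\dots,k\}$ put $$d_{ij}=i(j-1)+2g,$$ and let $f_{ij}\in\mathcal{L}(d_{ij}P_\infty)$ be any functions with $v_{P_\infty}(f_{ij})=-d_{ij}$, where $\mathcal{L}(D)$ is the Riemann–Roch space of a divisor $D$. For $P\in S$ let $E(P)=(f_{ij}(P))_{i,j}\in\mathbb{F}_q^{r\times k}$. Then for every matrix $M\in\mathbb{F}_q^{k\times r}$ of full rank $r$, the number of places $P\in S$ for which $E(P)M\in\mathbb{F}_q^{r\times r}$ does not have full rank is finite and at most $$r\left(\frac{(r+1)(3k-r-2)}{6}+2g\right).$$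 -/

import Mathlib

namespace FunField

/-- `F` is a finitely generated function field of transcendence degree one over `K`. -/
structure IsFunctionField (K F : Type*) [Field K] [Field F] [Algebra K F] : Prop where
  fg : (⊤ : IntermediateField K F).FG
  trdeg_eq_one : Algebra.trdeg K F = 1

/-- A place of `F` over `K`: a normalized discrete valuation `v : F → ℤ ∪ {∞}`, trivial on `K`.
An additive valuation of the field `F` takes the value `⊤` exactly at `0`. -/
@[ext]
structure Place (K F : Type*) [Field K] [Field F] [Algebra K F] where
  /-- the valuation of the place -/
  v : AddValuation F (WithTop ℤ)
  trivial_on : ∀ c : K, c ≠ 0 → v (algebraMap K F c) = 0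
  normalized : ∀ n : ℤ, ∃ x : F, v x = (n : WithTop ℤ)

section

variable {K F : Type*} [Field K] [Field F] [Algebra K F]

namespace Place

theorem v_algebraMap_nonneg (P : Place K F) (c : K) : 0 ≤ P.v (algebraMap K F c) := by
  by_cases hc : c = 0
  · simp [hc]
  · exact (P.trivial_on c hc).ge

/-- The valuation ring `𝒪_P = {x | v_P(x) ≥ 0}`, as a `K`-subalgebra of `F`. -/
def valuationRing (P : Place K F) : Subalgebra K F where
  carrier := {x | 0 ≤ P.v x}
  mul_mem' := by
    intro a b ha hb
    simp only [Set.mem_ofPred_eq] at ha hb ⊢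
    rw [P.v.map_mul]
    exact add_nonneg ha hb
  add_mem' := by
    intro a b ha hb
    exact le_trans (le_min ha hb) (P.v.map_add a b)
  algebraMap_mem' := P.v_algebraMap_nonneg

/-- The maximal ideal `𝔪_P = {x | v_P(x) > 0}` of the valuation ring. -/
def maximalIdeal (P : Place K F) : Ideal P.valuationRing where
  carrier := {x | 0 < P.v (x : F)}
  zero_mem' := by simp
  add_mem' := by
    intro a b ha hb
    exact lt_of_lt_of_le (lt_min ha hb) (P.v.map_add (a : F) (b : F))
  smul_mem' := by
    intro c x hx
    simp only [Set.mem_ofPred_eq, smul_eq_mul, MulMemClass.coe_mul] at hx ⊢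
    rw [P.v.map_mul]
    exact lt_of_lt_of_le hx (le_add_of_nonneg_left c.2)

/-- The residue field `κ_P = 𝒪_P / 𝔪_P`. -/
abbrev ResidueField (P : Place K F) : Type _ := P.valuationRing ⧸ P.maximalIdeal

/-- The degree `deg P = [κ_P : K]`. -/
noncomputable def degree (P : Place K F) : ℕ := Module.finrank K P.ResidueField

/-- A place is rational if it has degree one. -/
def IsRational (P : Place K F) : Prop := P.degree = 1

theorem IsRational.bijective {P : Place K F} (hP : P.IsRational) :
    Function.Bijective (Algebra.ofId K P.ResidueField) := by
  have : Module.Free K P.ResidueField := Module.Free.of_divisionRing K P.ResidueField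
  exact Algebra.finrank_eq_one_iff_bijective_algebraMap.mp hP

/-- Evaluation `f ↦ f(P) ∈ K` at a rational place `P`, for `f ∈ 𝒪_P`: the image of `f` in the
residue field `κ_P`, which is identified with `K` through the structure map `K → κ_P`. -/
noncomputable def eval (P : Place K F) (hP : P.IsRational) : P.valuationRing →ₐ[K] K :=
  ((AlgEquiv.ofBijective (Algebra.ofId K P.ResidueField) hP.bijective).symm.toAlgHom).comp (Ideal.Quotient.mkₐ K P.maximalIdeal)

end Place

/-- Divisors: formal integer linear combinations of places. -/
abbrev Divisor (K F : Type*) [Field K] [Field F] [Algebra K F] : Type _ := Place K F →₀ ℤ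

/-- The degree of a divisor. -/
noncomputable def Divisor.degree (D : Divisor K F) : ℤ := D.sum fun P n => n * (P.degree : ℤ)

/-- The Riemann–Roch space `ℒ(D)`: all `f` with `v_P(f) + D(P) ≥ 0` at every place `P`
(this includes `f = 0`, for which `v_P(f) = ∞`). -/
def rrSpace (D : Divisor K F) : Submodule K F where
  carrier := {f | ∀ P : Place K F, 0 ≤ P.v f + ((D P : ℤ) : WithTop ℤ)}
  zero_mem' := by intro P; simp
  add_mem' := by
    intro a b ha hb P
    rcases min_le_iff.mp (P.v.map_add a b) with h | h
    · exact (ha P).trans (by gcongr)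
    · exact (hb P).trans (by gcongr)
  smul_mem' := by
    intro c x hx P
    rw [Algebra.smul_def, P.v.map_mul, add_assoc]
    exact add_nonneg (P.v_algebraMap_nonneg c) (hx P)

/-- `ℓ(D) = dim_K ℒ(D)`. -/
noncomputable def ell (D : Divisor K F) : ℕ := Module.finrank K (rrSpace D)

/-- A function in `ℒ(n Q)` is regular at every place `P ≠ Q`. -/
theorem mem_valuationRing_of_mem_rrSpace {P Q : Place K F} (hPQ : P ≠ Q) {n : ℤ} {f : F}
    (hf : f ∈ rrSpace (Finsupp.single Q n)) : f ∈ P.valuationRing := by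
  have h := hf P
  rw [Finsupp.single_eq_of_ne hPQ] at h
  have h' : 0 ≤ P.v f := by simpa using h
  exact h'

end

/-- The genus of `F` over `K`: the integer `g ≥ 0` for which there is a (canonical) divisor `W`
with `ℓ(D) = deg D + 1 - g + ℓ(W - D)` for all divisors `D`. If `K` is the full constant field
of the function field `F`, as it is whenever `F` has a rational place, there is exactly one such
`g`. -/
noncomputable def genus (K F : Type*) [Field K] [Field F] [Algebra K F] : ℕ :=
  sInf {g : ℕ | ∃ W : Divisor K F, ∀ D : Divisor K F,
    (ell D : ℤ) = D.degree + 1 - (g : ℤ) + (ell (W - D) : ℤ)}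

/-- The set `S` of rational places other than `Pinf`. -/
abbrev RationalPlacesAway {K F : Type*} [Field K] [Field F] [Algebra K F] (Pinf : Place K F) :
    Type _ :=
  {P : Place K F // P.IsRational ∧ P ≠ Pinf}

/-- The pole orders `d_{ij} = i (j - 1) + 2 g` for `i ∈ [r]`, `j ∈ [k]`; the elements `i : Fin r`
and `j : Fin k` stand for the indices `i + 1` and `j + 1`. -/
def poleOrder (g : ℕ) {r k : ℕ} (i : Fin r) (j : Fin k) : ℕ := ((i : ℕ) + 1) * (j : ℕ) + 2 * g

/-- The matrix `E(P) = (f_{ij}(P))` over `K`, for functions `f_{ij} ∈ ℒ(d_{ij} Pinf)` and a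
rational place `P ≠ Pinf`. -/
noncomputable def evalMatrix {K F : Type*} [Field K] [Field F] [Algebra K F] {r k : ℕ}
    {Pinf : Place K F} {d : Fin r → Fin k → ℕ} (f : Matrix (Fin r) (Fin k) F)
    (hf : ∀ i j, f i j ∈ rrSpace (Finsupp.single Pinf (d i j : ℤ)))
    (P : RationalPlacesAway Pinf) : Matrix (Fin r) (Fin k) K :=
  Matrix.of fun i j =>
    P.1.eval P.2.1 ⟨f i j, mem_valuationRing_of_mem_rrSpace P.2.2 (hf i j)⟩

end FunField

/-! Column operations turn `M` into `M * U`, whose columns have their last nonzero entries in rows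
j_1 < ... < j_r. In each row of `f` the pole orders at P_∞ increase strictly, so entry (i, s) of `f
* M * U` has pole order exactly i(j_s - 1) + 2g. By the rearrangement inequality, the identity
permutation alone attains the largest pole order in the Leibniz expansion. Hence det(fM) has pole
order exactly N = ∑ d_{i,j_i} (`Place.exists_v_det_mul_eq`), and j_i ≤ k - r + i bounds N by the
stated number (`sum_poleOrder_le`). Evaluation at P is a ring homomorphism, so E(P)M is singular
only where det(fM) vanishes.

It remains to see that an element h of the ring A of functions regular away from P_∞, with pole
order N there, has at most N rational zeros (`IsFunctionField.finite_zeros`). The degree theory of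
principal divisors is avoided. First, A/hA has dimension at most N: leading terms at the rational
place P_∞ can be cancelled, and a nonzero element of A cannot vanish at P_∞
(`IsFunctionField.ord_nonpos`, which rests on `IsFunctionField.exists_place_pos`). Second,
evaluations at zeros of h are algebra homomorphisms A → K killing hA. They are distinct for distinct
places (`IsFunctionField.evalAway_injOn`), hence linearly independent by Dedekind. -/

namespace FunField

open Polynomial

/-! ### Existence of a place at which a given transcendental function vanishes -/

section ExistencePlaces

variable {K F : Type*} [Field K] [Field F] [Algebra K F]

theorem _root_.Polynomial.exists_eq_X_pow_mul_coeff_zero_ne_zero {R : Type*} [CommRing R]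
    {p : R[X]} (hp : p ≠ 0) : ∃ (n : ℕ) (q : R[X]), p = X ^ n * q ∧ q.coeff 0 ≠ 0 := by
  obtain ⟨q, hq⟩ := X_pow_dvd_iff.mpr
    (fun d hd => coeff_eq_zero_of_lt_natTrailingDegree (p := p) hd)
  refine ⟨p.natTrailingDegree, q, hq, ?_⟩
  have h := mt trailingCoeff_eq_zero.mp hp
  rw [trailingCoeff] at h
  nth_rw 1 [hq] at h
  rwa [coeff_X_pow_mul', if_pos le_rfl, Nat.sub_self] at h

theorem IsFunctionField.isAlgebraic_adjoin (hF : IsFunctionField K F) {y : F}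
    (hy : Transcendental K y) : Algebra.IsAlgebraic (Algebra.adjoin K {y}) F := by
  have hind : AlgebraicIndependent K ((↑) : ({y} : Set F) → F) :=
    (algebraicIndependent_unique_type_iff).mpr hy
  have := (hind.isTranscendenceBasis_of_trdeg_le_of_finite
    (by rw [hF.trdeg_eq_one]; simp)).isAlgebraic
  rwa [Subtype.range_coe] at this

open IntermediateField in
theorem IsFunctionField.finiteDimensional_adjoin (hF : IsFunctionField K F) {y : F}
    (hy : Transcendental K y) : FiniteDimensional K⟮y⟯ F := by
  have h1 : Algebra.IsAlgebraic K⟮y⟯ F := by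
    have := hF.isAlgebraic_adjoin hy
    refine ⟨fun x => ?_⟩
    exact (this.isAlgebraic x).tower_top_of_subalgebra_le
      (B := K⟮y⟯.toSubalgebra) (algebra_adjoin_le_adjoin K {y})
  have h2 : Algebra.EssFiniteType K F := by
    have := (IntermediateField.essFiniteType_iff (K := (⊤ : IntermediateField K F))).mpr hF.fg
    exact Algebra.EssFiniteType.of_surjective (IntermediateField.topEquiv (F := K) (E := F)).toAlgHom
      (IntermediateField.topEquiv (F := K) (E := F)).surjective
  have h3 : Algebra.EssFiniteType K⟮y⟯ F := Algebra.EssFiniteType.of_comp K K⟮y⟯ F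
  exact Algebra.finite_of_essFiniteType_of_isAlgebraic

/-- If a single term had the largest value, the sum would share that nonzero value; so the maximum
is attained twice. -/
theorem _root_.Valuation.exists_eq_of_sum_eq_zero {R Γ ι : Type*} [Ring R]
    [LinearOrderedCommMonoidWithZero Γ] (w : Valuation R Γ) {s : Finset ι}
    {f : ι → R} (hs : ∑ i ∈ s, f i = 0) (hne : ∃ i ∈ s, w (f i) ≠ 0) :
    ∃ i ∈ s, ∃ j ∈ s, i ≠ j ∧ w (f i) = w (f j) ∧ w (f i) ≠ 0 := by
  classical
  obtain ⟨i₀, hi₀, h₀⟩ := hne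
  obtain ⟨i, hi, hmax⟩ := s.exists_max_image (fun i => w (f i)) ⟨i₀, hi₀⟩
  have hpos : w (f i) ≠ 0 := fun h => h₀ (le_zero_iff.mp (h ▸ hmax i₀ hi₀))
  by_contra! H
  refine hpos ?_
  rw [← w.map_sum_eq_of_lt hi, hs, map_zero]
  intro j hj
  rw [Finset.mem_sdiff, Finset.mem_singleton] at hj
  exact lt_of_le_of_ne (hmax j hj.1) fun h => hpos (H i hi j hj.1 (Ne.symm hj.2) h.symm)

section

variable {Γ : Type*} [LinearOrderedCommGroupWithZero Γ]

/-- Split off the largest power of X: the cofactor at y is a nonzero constant plus a multiple of y,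
so it has value 1. -/
theorem valuation_aeval_eq_zpow (w : Valuation F Γ) (hw : ∀ c : K, c ≠ 0 → w (algebraMap K F c) = 1)
    {y : F} (hy : w y < 1) {p : K[X]} (hp : p ≠ 0) : ∃ m : ℤ, w (aeval y p) = w y ^ m := by
  obtain ⟨n, q, rfl, hq⟩ := exists_eq_X_pow_mul_coeff_zero_ne_zero hp
  refine ⟨n, ?_⟩
  have hle : ∀ r : K[X], w (aeval y r) ≤ 1 := fun r => by
    rw [aeval_eq_sum_range]
    refine w.map_sum_le fun i _ => ?_
    rw [Algebra.smul_def, map_mul, map_pow]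
    refine mul_le_one' ?_ (pow_le_one' hy.le _)
    by_cases hc : r.coeff i = 0
    · simp [hc]
    · exact (hw _ hc).le
  have h1 : w (aeval y q) = 1 := by
    rw [← divX_mul_X_add q]
    simp only [map_add, map_mul, aeval_X, aeval_C]
    rw [w.map_add_eq_of_lt_right, hw _ hq]
    rw [hw _ hq, map_mul]
    exact mul_lt_one_of_nonneg_of_lt_one_right (hle _) zero_le hy
  simp [h1]

open IntermediateField in
theorem exists_valuation_pow_eq_zpow (w : Valuation F Γ)
    (hw : ∀ c : K, c ≠ 0 → w (algebraMap K F c) = 1)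
    {y : F} (hy0 : y ≠ 0) (hy : w y < 1) [FiniteDimensional K⟮y⟯ F] :
    ∃ e : ℕ, 0 < e ∧ ∀ x : F, x ≠ 0 → ∃ m : ℤ, w x ^ e = w y ^ m := by
  have hL : ∀ a : K⟮y⟯, a ≠ 0 → ∃ m : ℤ, w (a : F) = w y ^ m := by
    intro a ha
    obtain ⟨r, s, hrs⟩ := (mem_adjoin_simple_iff K (a : F)).mp a.2
    have ha' : (a : F) ≠ 0 := by simpa using ha
    have hr : r ≠ 0 := by rintro rfl; simp [hrs] at ha'
    have hs : s ≠ 0 := by rintro rfl; simp [hrs] at ha'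
    obtain ⟨m, hm⟩ := valuation_aeval_eq_zpow w hw hy hr
    obtain ⟨n, hn⟩ := valuation_aeval_eq_zpow w hw hy hs
    refine ⟨m - n, ?_⟩
    rw [hrs, map_div₀, hm, hn, zpow_sub₀ (w.ne_zero_iff.mpr hy0)]
  set n := Module.finrank K⟮y⟯ F
  -- A linear relation among 1, x, ..., x^n over K(y) has two terms of equal value, so some x^d with
  -- 1 ≤ d ≤ n has its value in the powers of `w y`. Every such d divides n!, which makes the
  -- exponent uniform in x.
  refine ⟨n.factorial, n.factorial_pos, fun x hx => ?_⟩
  have hdep : ¬ LinearIndependent K⟮y⟯ (fun i : Fin (n + 1) => x ^ (i : ℕ)) := fun h => by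
    simpa [n] using h.fintype_card_le_finrank
  obtain ⟨g, hg, i₀, hi₀⟩ := Fintype.not_linearIndependent_iff.mp hdep
  have hterm : ∀ i, w (g i • x ^ (i : ℕ)) = w (g i : F) * w x ^ (i : ℕ) := fun i => by
    rw [IntermediateField.smul_def, smul_eq_mul, map_mul, map_pow]
  have hwx : w x ≠ 0 := w.ne_zero_iff.mpr hx
  have hwy : w y ≠ 0 := w.ne_zero_iff.mpr hy0
  obtain ⟨i, -, j, -, hij, heq, hne⟩ := w.exists_eq_of_sum_eq_zero hg
    ⟨i₀, Finset.mem_univ _, by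
      rw [hterm]; exact mul_ne_zero (w.ne_zero_iff.mpr (by simpa using hi₀)) (pow_ne_zero _ hwx)⟩
  wlog hlt : i < j generalizing i j
  · exact this j i hij.symm heq.symm (heq ▸ hne) (lt_of_le_of_ne (not_lt.mp hlt) hij.symm)
  have hgi : g i ≠ 0 := by rintro h; simp [h] at hne
  have hgj : g j ≠ 0 := by rintro h; rw [heq] at hne; simp [h] at hne
  obtain ⟨a, ha⟩ := hL _ hgi
  obtain ⟨b, hb⟩ := hL _ hgj
  rw [hterm, hterm, ha, hb] at heq
  obtain ⟨d, hd⟩ := Nat.exists_eq_add_of_lt (Fin.lt_def.mp hlt)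
  have hpow : w x ^ (d + 1) = w y ^ (a - b) := by
    rw [zpow_sub₀ hwy, eq_div_iff (zpow_ne_zero _ hwy)]
    rw [hd, add_assoc, pow_add] at heq
    have := pow_ne_zero (i : ℕ) hwx
    apply mul_right_cancel₀ this
    rw [mul_right_comm, mul_comm _ (w y ^ b), mul_comm (w x ^ (d + 1)), ← heq]
  obtain ⟨c, hc⟩ : d + 1 ∣ n.factorial := Nat.dvd_factorial d.succ_pos (by omega)
  exact ⟨(a - b) * c, by rw [hc, pow_mul, hpow, zpow_mul, zpow_natCast]⟩

/-- A valuation whose values have a common power in the group generated by some value `w y < 1`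
is equivalent to a normalized discrete one. -/
theorem exists_place_of_valuation (w : Valuation F Γ)
    (hw : ∀ c : K, c ≠ 0 → w (algebraMap K F c) = 1)
    {y : F} (hy0 : y ≠ 0) (hy : w y < 1) {e : ℕ} (he : 0 < e)
    (hpow : ∀ x : F, x ≠ 0 → ∃ m : ℤ, w x ^ e = w y ^ m) :
    ∃ P : Place K F, 0 < P.v y := by
  have hwy : 0 < w y := zero_lt_iff.mpr (w.ne_zero_iff.mpr hy0)
  have hinj : ∀ {m n : ℤ}, w y ^ m ≤ w y ^ n ↔ n ≤ m := zpow_le_zpow_iff_right_of_lt_one₀ hwy hy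
  have hinj' : ∀ {m n : ℤ}, w y ^ m = w y ^ n → m = n := fun h =>
    le_antisymm (hinj.mp h.ge) (hinj.mp h.le)
  choose! m hm using hpow
  have hone : m 1 = 0 := hinj' (by rw [← hm 1 one_ne_zero, map_one, one_pow, zpow_zero])
  have hmul : ∀ a b : F, a ≠ 0 → b ≠ 0 → m (a * b) = m a + m b := fun a b ha hb => hinj' <| by
    rw [← hm _ (mul_ne_zero ha hb), zpow_add₀ hwy.ne', ← hm _ ha, ← hm _ hb, map_mul, mul_pow]
  have hmono : ∀ a b : F, a ≠ 0 → b ≠ 0 → w a ≤ w b → m b ≤ m a := fun a b ha hb h => by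
    rw [← hinj, ← hm a ha, ← hm b hb]; gcongr
  have hmy : m y = e := hinj' (by rw [← hm y hy0, zpow_natCast])
  have hmc : ∀ c : K, c ≠ 0 → m (algebraMap K F c) = 0 := fun c hc => hinj' <| by
    rw [← hm _ (by simpa using hc), hw c hc, one_pow, zpow_zero]
  -- The exponents `m x` form a subgroup of ℤ, nonzero because `m y = e`. Dividing by its positive
  -- generator D yields the normalized valuation ν.
  let H : AddSubgroup ℤ :=
    { carrier := {n | ∃ x : F, x ≠ 0 ∧ m x = n}
      zero_mem' := ⟨1, one_ne_zero, hone⟩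
      add_mem' := by
        rintro _ _ ⟨a, ha, rfl⟩ ⟨b, hb, rfl⟩
        exact ⟨a * b, mul_ne_zero ha hb, hmul a b ha hb⟩
      neg_mem' := by
        rintro _ ⟨a, ha, rfl⟩
        refine ⟨a⁻¹, inv_ne_zero ha, ?_⟩
        have := hmul a a⁻¹ ha (inv_ne_zero ha)
        rw [mul_inv_cancel₀ ha, hone] at this
        omega }
  obtain ⟨D, hD, hdvd, x₀, hx₀, hmx₀⟩ : ∃ D : ℤ, 0 < D ∧ (∀ x : F, x ≠ 0 → D ∣ m x) ∧
      ∃ x : F, x ≠ 0 ∧ m x = D := by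
    obtain ⟨d, hd⟩ := Int.subgroup_cyclic H
    rw [← AddSubgroup.zmultiples_eq_closure] at hd
    have hdvd : ∀ x : F, x ≠ 0 → d ∣ m x := fun x hx => by
      rw [← Int.mem_zmultiples_iff, ← hd]; exact ⟨x, hx, rfl⟩
    have hd0 : d ≠ 0 := by
      rintro rfl
      have := hdvd y hy0
      rw [hmy] at this
      simp at this
      omega
    refine ⟨|d|, abs_pos.mpr hd0, fun x hx => (abs_dvd _ _).mpr (hdvd x hx), ?_⟩
    change |d| ∈ H
    rw [hd, Int.mem_zmultiples_iff]
    exact (dvd_abs _ _).mpr dvd_rfl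
  choose! ν hν using hdvd
  have hνmul : ∀ a b : F, a ≠ 0 → b ≠ 0 → ν (a * b) = ν a + ν b := fun a b ha hb => by
    have := hmul a b ha hb
    rw [hν _ (mul_ne_zero ha hb), hν a ha, hν b hb, ← mul_add] at this
    exact mul_left_cancel₀ hD.ne' this
  have hν0 : ∀ a : F, a ≠ 0 → m a = 0 → ν a = 0 := fun a ha h => by
    rw [hν a ha] at h
    exact (mul_eq_zero.mp h).resolve_left hD.ne'
  have hνmono : ∀ a b : F, a ≠ 0 → b ≠ 0 → w a ≤ w b → ν b ≤ ν a := fun a b ha hb h => by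
    have := hmono a b ha hb h
    rw [hν a ha, hν b hb] at this
    exact le_of_mul_le_mul_left this hD
  classical
  let V : F → WithTop ℤ := fun x => if x = 0 then ⊤ else (ν x : WithTop ℤ)
  have hV : ∀ x, x ≠ 0 → V x = (ν x : WithTop ℤ) := fun x hx => if_neg hx
  have hV0 : V 0 = ⊤ := if_pos rfl
  let v : AddValuation F (WithTop ℤ) := AddValuation.of V hV0
    (by rw [hV 1 one_ne_zero, hν0 1 one_ne_zero hone]; rfl)
    (by
      intro a b
      by_cases ha : a = 0
      · simp [ha, hV0]
      by_cases hb : b = 0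
      · simp [hb, hV0]
      by_cases hab : a + b = 0
      · simp [hab, hV0]
      rw [hV a ha, hV b hb, hV _ hab, min_le_iff, WithTop.coe_le_coe, WithTop.coe_le_coe]
      rcases le_total (w a) (w b) with h | h
      · exact Or.inr (hνmono _ _ hab hb (w.map_add_le h le_rfl))
      · exact Or.inl (hνmono _ _ hab ha (w.map_add_le le_rfl h)))
    (by
      intro a b
      by_cases ha : a = 0
      · simp [ha, hV0]
      by_cases hb : b = 0
      · simp [hb, hV0]
      rw [hV a ha, hV b hb, hV _ (mul_ne_zero ha hb), hνmul a b ha hb, WithTop.coe_add])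
  have hνx₀ : ν x₀ = 1 := by
    have := hν x₀ hx₀
    rw [hmx₀] at this
    exact (mul_eq_left₀ hD.ne').mp this.symm
  have hpow' : ∀ n : ℕ, ν (x₀ ^ n) = n := fun n => by
    induction n with
    | zero => simpa using hν0 1 one_ne_zero hone
    | succ n ih => rw [pow_succ, hνmul _ _ (pow_ne_zero _ hx₀) hx₀, ih, hνx₀]; push_cast; rfl
  refine ⟨⟨v, fun c hc => ?_, fun n => ?_⟩, ?_⟩
  · have hc' : algebraMap K F c ≠ 0 := by simpa using hc
    exact (hV _ hc').trans (by rw [hν0 _ hc' (hmc c hc)]; rfl)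
  · obtain ⟨k, rfl | rfl⟩ := n.eq_nat_or_neg
    · exact ⟨x₀ ^ k, (hV _ (pow_ne_zero _ hx₀)).trans (by rw [hpow'])⟩
    · have hk := pow_ne_zero k hx₀
      refine ⟨(x₀ ^ k)⁻¹, (hV _ (inv_ne_zero hk)).trans ?_⟩
      have := hνmul _ _ hk (inv_ne_zero hk)
      rw [mul_inv_cancel₀ hk, hν0 1 one_ne_zero hone, hpow'] at this
      congr 1; omega
  · refine lt_of_lt_of_eq (b := ((ν y : ℤ) : WithTop ℤ)) ?_ (hV y hy0).symm
    have := hν y hy0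
    rw [hmy] at this
    have h : 0 < ν y := pos_of_mul_pos_right (by omega : 0 < D * ν y) hD.le
    exact_mod_cast h

end

/-- The ideal (y) of K[y] is proper, so some valuation ring of F contains K[y] and has y as a
nonunit. Finiteness of F over K(y) makes its valuation discrete. -/
theorem IsFunctionField.exists_place_pos (hF : IsFunctionField K F) {y : F}
    (hy : Transcendental K y) : ∃ P : Place K F, 0 < P.v y := by
  let A : Subring F := (Algebra.adjoin K {y}).toSubring
  let y' : A := ⟨y, Algebra.self_mem_adjoin_singleton K y⟩
  have hI : Ideal.span {y'} ≠ ⊤ := by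
    rw [Ne, Ideal.span_singleton_eq_top]
    intro h
    obtain ⟨⟨b, hb⟩, hb'⟩ := h.exists_right_inv
    change b ∈ Algebra.adjoin K {y} at hb
    rw [Algebra.adjoin_singleton_eq_range_aeval] at hb
    obtain ⟨p, rfl⟩ := hb
    have h1 : aeval y (X * p - 1) = 0 := by
      have := congrArg Subtype.val hb'
      simp only [map_sub, map_mul, aeval_X, map_one]
      exact sub_eq_zero.mpr this
    have h2 := transcendental_iff.mp hy _ h1
    simpa using congrArg (eval 0) h2
  obtain ⟨B, hAB, hB⟩ := Ideal.image_subset_nonunits_valuationSubring _ hI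
  have hy0 : y ≠ 0 := fun h => hy (h ▸ isAlgebraic_zero)
  have hK : ∀ c : K, B.valuation (algebraMap K F c) ≤ 1 := fun c =>
    (B.valuation_le_one_iff _).mpr (hAB (Subalgebra.algebraMap_mem _ c))
  have hw : ∀ c : K, c ≠ 0 → B.valuation (algebraMap K F c) = 1 := fun c hc => by
    refine le_antisymm (hK c) ?_
    have h := hK c⁻¹
    rw [map_inv₀, map_inv₀] at h
    exact (inv_le_one₀ (zero_lt_iff.mpr (by simpa using hc))).mp h
  have hyB : B.valuation y < 1 := B.mem_nonunits_iff.mp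
    (hB ⟨y', Ideal.subset_span rfl, rfl⟩)
  have := hF.finiteDimensional_adjoin hy
  obtain ⟨e, he, hpow⟩ := exists_valuation_pow_eq_zpow B.valuation hw hy0 hyB
  exact exists_place_of_valuation B.valuation hw hy0 hyB he hpow

end ExistencePlaces

/-! ### Integer orders, residues and transcendence at a place -/

variable {K F : Type*} [Field K] [Field F] [Algebra K F]

theorem aeval_mem_of_mem {A : Subalgebra K F} {x : F} (hx : x ∈ A) (q : K[X]) :
    aeval x q ∈ A :=
  aeval_algHom_apply A.val ⟨x, hx⟩ q ▸ (aeval (⟨x, hx⟩ : A) q).2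

namespace Place

theorem v_ne_top (P : Place K F) {x : F} (hx : x ≠ 0) : P.v x ≠ ⊤ :=
  P.v.ne_top_iff.mpr hx

/-- The integer value `v_P(x)` for `x ≠ 0` (and `0` for `x = 0`). -/
noncomputable def ord (P : Place K F) (x : F) : ℤ := (P.v x).untopD 0

theorem coe_ord (P : Place K F) {x : F} (hx : x ≠ 0) : (P.ord x : WithTop ℤ) = P.v x := by
  obtain ⟨n, hn⟩ := WithTop.ne_top_iff_exists.mp (P.v_ne_top hx)
  rw [ord, ← hn]; rfl

theorem ord_eq (P : Place K F) {x : F} {n : ℤ} (h : P.v x = n) : P.ord x = n := by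
  rw [ord, h]; rfl

theorem ne_zero_of_v_eq (P : Place K F) {x : F} {n : ℤ} (h : P.v x = n) : x ≠ 0 := by
  rintro rfl
  rw [P.v.map_zero] at h
  exact WithTop.coe_ne_top h.symm

theorem ord_mul (P : Place K F) {x y : F} (hx : x ≠ 0) (hy : y ≠ 0) :
    P.ord (x * y) = P.ord x + P.ord y :=
  P.ord_eq (by rw [P.v.map_mul, ← P.coe_ord hx, ← P.coe_ord hy, WithTop.coe_add])

theorem ord_one (P : Place K F) : P.ord 1 = 0 := P.ord_eq (by simp)

theorem ord_pow (P : Place K F) {x : F} (hx : x ≠ 0) (n : ℕ) : P.ord (x ^ n) = n * P.ord x := by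
  induction n with
  | zero => simp [ord_one]
  | succ n ih => rw [pow_succ, P.ord_mul (pow_ne_zero _ hx) hx, ih]; push_cast; ring

theorem ord_inv (P : Place K F) {x : F} (hx : x ≠ 0) : P.ord x⁻¹ = - P.ord x := by
  have h := P.ord_mul hx (inv_ne_zero hx)
  rw [mul_inv_cancel₀ hx, ord_one] at h
  omega

theorem zero_le_ord_iff (P : Place K F) {x : F} (hx : x ≠ 0) : 0 ≤ P.ord x ↔ 0 ≤ P.v x := by
  rw [← P.coe_ord hx]; exact_mod_cast Iff.rfl

theorem ord_pos_iff (P : Place K F) {x : F} (hx : x ≠ 0) : 0 < P.ord x ↔ 0 < P.v x := by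
  rw [← P.coe_ord hx]; exact_mod_cast Iff.rfl

theorem mem_valuationRing (P : Place K F) {x : F} : x ∈ P.valuationRing ↔ 0 ≤ P.v x := Iff.rfl

theorem eval_eq_zero_iff (P : Place K F) (hP : P.IsRational) (x : P.valuationRing) :
    P.eval hP x = 0 ↔ 0 < P.v (x : F) := by
  have h : P.eval hP x = (AlgEquiv.ofBijective (Algebra.ofId K P.ResidueField) hP.bijective).symm
      (Ideal.Quotient.mk P.maximalIdeal x) := rfl
  rw [h, EmbeddingLike.map_eq_zero_iff, Ideal.Quotient.eq_zero_iff_mem]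
  rfl

theorem IsRational.exists_sub_pos {P : Place K F} (hP : P.IsRational) {x : F} (hx : 0 ≤ P.v x) :
    ∃ c : K, 0 < P.v (x - algebraMap K F c) := by
  let x' : P.valuationRing := ⟨x, hx⟩
  refine ⟨P.eval hP x', (P.eval_eq_zero_iff hP (x' - algebraMap K _ (P.eval hP x'))).mp ?_⟩
  rw [map_sub, AlgHom.commutes]
  exact sub_self _

/-- An algebraic relation, freed of powers of X, would express a nonzero constant as a multiple of
x, which has positive valuation. -/
theorem transcendental_of_pos (P : Place K F) {x : F} (hx0 : x ≠ 0) (hx : 0 < P.v x) :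
    Transcendental K x := by
  rintro ⟨p, hp, hpx⟩
  obtain ⟨n, q, rfl, hq⟩ := exists_eq_X_pow_mul_coeff_zero_ne_zero hp
  have hqx : aeval x q = 0 := by
    rw [map_mul, map_pow, aeval_X] at hpx
    exact (mul_eq_zero.mp hpx).resolve_left (pow_ne_zero _ hx0)
  have hdiv : 0 ≤ P.v (aeval x q.divX) :=
    P.mem_valuationRing.mp (aeval_mem_of_mem (P.mem_valuationRing.mpr hx.le) _)
  have h1 : 0 < P.v (aeval x q.divX * x) := by
    rw [P.v.map_mul]; exact lt_of_lt_of_le hx (le_add_of_nonneg_left hdiv)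
  rw [← divX_mul_X_add q, map_add, map_mul, aeval_X, aeval_C] at hqx
  rw [eq_neg_of_add_eq_zero_left hqx, P.v.map_neg, P.trivial_on _ hq] at h1
  exact lt_irrefl _ h1

theorem transcendental_of_ne_zero (P : Place K F) {x : F} (hx0 : x ≠ 0) (hx : P.v x ≠ 0) :
    Transcendental K x := by
  rcases lt_or_gt_of_ne hx with h | h
  · intro halg
    refine P.transcendental_of_pos (inv_ne_zero hx0) ?_ halg.inv
    rw [← P.ord_pos_iff (inv_ne_zero hx0), P.ord_inv hx0]
    rw [← P.coe_ord hx0] at h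
    have : P.ord x < 0 := by exact_mod_cast h
    omega
  · exact P.transcendental_of_pos hx0 h

end Place

/-! ### Places determined by the signs of their valuations -/

/-- Two surjective homomorphisms to `ℤ` which never have opposite signs agree. -/
theorem _root_.AddMonoidHom.eq_of_same_sign {G : Type*} [AddCommGroup G] {p q : G →+ ℤ}
    (hp : Function.Surjective p) (hq : Function.Surjective q)
    (h : ∀ g, (0 ≤ p g ∧ 0 ≤ q g) ∨ (p g ≤ 0 ∧ q g ≤ 0)) : p = q := by
  obtain ⟨t, ht⟩ := hp 1
  have key : ∀ g, p g = 0 → q g ≤ 0 := fun g hg => by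
    by_contra! hlt
    -- On this element p is -1, while the multiple of g is large enough to make q positive.
    have h1 := h ((|q t| + 1) • g - t)
    simp only [map_sub, map_zsmul, hg, ht, smul_eq_mul, mul_zero] at h1
    have h2 : q t < (|q t| + 1) * q g := by nlinarith [le_abs_self (q t), abs_nonneg (q t)]
    omega
  have key' : ∀ g, p g = 0 → q g = 0 := fun g hg =>
    le_antisymm (key g hg) (by simpa using key (-g) (by simp [hg]))
  have hlin : ∀ g, q g = p g * q t := fun g => by
    have := key' (g - p g • t) (by simp [ht])
    rw [map_sub, map_zsmul, smul_eq_mul] at this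
    omega
  obtain ⟨s, hs⟩ := hq 1
  -- As q is `q t` times p and surjective, `q t` is ±1; the sign condition at t, where p is 1,
  -- excludes -1.
  have h1 : q t = 1 := by
    have h2 := hlin s
    rw [hs] at h2
    have h3 := h t
    rcases Int.eq_one_or_neg_one_of_mul_eq_one' h2.symm with h4 | h4 <;> omega
  ext g
  rw [hlin g, h1, mul_one]

theorem Place.eq_of_same_sign {P Q : Place K F}
    (h : ∀ x : F, (0 ≤ P.v x ∧ 0 ≤ Q.v x) ∨ (P.v x ≤ 0 ∧ Q.v x ≤ 0)) : P = Q := by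
  let φ : Place K F → (Additive Fˣ →+ ℤ) := fun R =>
    { toFun := fun x => R.ord (x.toMul : F)
      map_zero' := by simpa using R.ord_one
      map_add' := fun a b => by
        rw [toMul_add, Units.val_mul, R.ord_mul a.toMul.ne_zero b.toMul.ne_zero] }
  have hsurj : ∀ R, Function.Surjective (φ R) := fun R n => by
    obtain ⟨x, hx⟩ := R.normalized n
    exact ⟨Additive.ofMul (Units.mk0 x (R.ne_zero_of_v_eq hx)), R.ord_eq hx⟩
  have heq : φ P = φ Q := AddMonoidHom.eq_of_same_sign (hsurj P) (hsurj Q) fun g => by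
    have := h (g.toMul : F)
    rw [← P.coe_ord g.toMul.ne_zero, ← Q.coe_ord g.toMul.ne_zero] at this
    exact_mod_cast this
  ext x
  by_cases hx : x = 0
  · simp [hx]
  · rw [← P.coe_ord hx, ← Q.coe_ord hx]
    exact congrArg _ (DFunLike.congr_fun heq (Additive.ofMul (Units.mk0 x hx)))

/-! ### The ring of functions regular away from P_∞ and its evaluations -/

/-- The `K`-algebra of functions without poles outside `Pinf`. -/
def regularAway (Pinf : Place K F) : Subalgebra K F :=
  ⨅ P : {P : Place K F // P ≠ Pinf}, P.1.valuationRing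

theorem mem_regularAway {Pinf : Place K F} {x : F} :
    x ∈ regularAway Pinf ↔ ∀ P, P ≠ Pinf → 0 ≤ P.v x := by
  simp [regularAway, Algebra.mem_iInf, Place.mem_valuationRing]

theorem regularAway_le {Pinf P : Place K F} (hP : P ≠ Pinf) :
    regularAway Pinf ≤ P.valuationRing := fun _ hx => mem_regularAway.mp hx P hP

/-- Evaluation of functions without poles outside `Pinf` at a rational place `P ≠ Pinf`. -/
noncomputable def evalAway {Pinf : Place K F} (P : RationalPlacesAway Pinf) :
    regularAway Pinf →ₐ[K] K :=
  (P.1.eval P.2.1).comp (Subalgebra.inclusion (regularAway_le P.2.2))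

theorem evalAway_eq_zero_iff {Pinf : Place K F} (P : RationalPlacesAway Pinf)
    (x : regularAway Pinf) : evalAway P x = 0 ↔ 0 < P.1.v (x : F) :=
  P.1.eval_eq_zero_iff P.2.1 _

theorem v_eq_zero_of_evalAway_ne_zero {Pinf : Place K F} {P : RationalPlacesAway Pinf}
    {x : regularAway Pinf} (h : evalAway P x ≠ 0) : P.1.v (x : F) = 0 := by
  rw [Ne, evalAway_eq_zero_iff, not_lt] at h
  exact le_antisymm h (mem_regularAway.mp x.2 _ P.2.2)

/-- A zero of 1/x is a pole of x, and P_∞ is the only place where x may have one. -/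
theorem IsFunctionField.v_neg_of_transcendental (hF : IsFunctionField K F) {Pinf : Place K F}
    {x : F} (hx : x ∈ regularAway Pinf) (ht : Transcendental K x) : Pinf.v x < 0 := by
  have hx0 : x ≠ 0 := fun h => ht (h ▸ isAlgebraic_zero)
  obtain ⟨P, hP⟩ := hF.exists_place_pos (y := x⁻¹) fun h => ht (by simpa using h.inv)
  rw [← P.ord_pos_iff (inv_ne_zero hx0), P.ord_inv hx0] at hP
  have hlt : P.v x < 0 := by
    rw [← P.coe_ord hx0]
    exact_mod_cast (by omega : P.ord x < 0)
  by_cases h : P = Pinf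
  · exact h ▸ hlt
  · exact absurd (mem_regularAway.mp hx P h) (not_le.mpr hlt)

theorem IsFunctionField.ord_nonpos (hF : IsFunctionField K F) {Pinf : Place K F}
    {x : F} (hx : x ∈ regularAway Pinf) (hx0 : x ≠ 0) : Pinf.ord x ≤ 0 := by
  by_contra! h
  rw [Pinf.ord_pos_iff hx0] at h
  exact lt_asymm h (hF.v_neg_of_transcendental hx (Pinf.transcendental_of_pos hx0 h))

/-- Take an algebraic relation for x over K[h] and divide out the largest power of h; then some
coefficient survives at h = 0. -/
theorem IsFunctionField.exists_relation (hF : IsFunctionField K F) {h : F}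
    (ht : Transcendental K h) (x : F) : ∃ p : K[X][X],
      p.eval₂ (aeval h : K[X] →ₐ[K] F).toRingHom x = 0 ∧ ∃ i, (p.coeff i).coeff 0 ≠ 0 := by
  obtain ⟨p, hp, hpx⟩ := (hF.isAlgebraic_adjoin ht).isAlgebraic x
  let ψ : K[X] →ₐ[K] Algebra.adjoin K {h} :=
    aeval ⟨h, Algebra.self_mem_adjoin_singleton K h⟩
  have hψ : ∀ q, (ψ q : F) = aeval h q := fun q => by
    have := aeval_algHom_apply (Algebra.adjoin K {h}).val
      (⟨h, Algebra.self_mem_adjoin_singleton K h⟩ : Algebra.adjoin K {h}) q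
    exact this.symm
  have hsurj : Function.Surjective ψ := by
    rintro ⟨b, hb⟩
    obtain ⟨q, rfl⟩ := (Algebra.adjoin_singleton_eq_range_aeval K h) ▸ hb
    exact ⟨q, Subtype.ext (hψ q)⟩
  obtain ⟨p, rfl⟩ := map_surjective (ψ : K[X] →+* Algebra.adjoin K {h}) hsurj p
  have hp0 : p ≠ 0 := by rintro rfl; simp at hp
  have hpx' : p.eval₂ (aeval h : K[X] →ₐ[K] F).toRingHom x = 0 := by
    rw [aeval_def, eval₂_map] at hpx
    rw [← hpx]
    congr 1
    exact RingHom.ext fun q => (hψ q).symm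
  have hnu : ¬ IsUnit (C X : K[X][X]) := by
    rw [isUnit_C]; exact not_isUnit_X
  obtain ⟨r, hr, hndvd⟩ := (FiniteMultiplicity.of_not_isUnit hnu hp0).exists_eq_pow_mul_and_not_dvd
  refine ⟨r, ?_, ?_⟩
  · rw [hr, eval₂_mul, eval₂_pow, eval₂_C] at hpx'
    refine (mul_eq_zero.mp hpx').resolve_left (pow_ne_zero _ ?_)
    simpa using fun h0 : h = 0 => ht (h0 ▸ isAlgebraic_zero)
  · rw [C_dvd_iff_dvd_coeff] at hndvd
    push Not at hndvd
    obtain ⟨i, hi⟩ := hndvd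
    exact ⟨i, by rwa [X_dvd_iff] at hi⟩

/-- Rational places with a common zero `h` are separated by the functions regular away from
`Pinf`. -/
theorem IsFunctionField.evalAway_injOn (hF : IsFunctionField K F) {Pinf : Place K F}
    (h : regularAway Pinf) (ht : Transcendental K (h : F)) {P Q : RationalPlacesAway Pinf}
    (hP : evalAway P h = 0) (heq : evalAway P = evalAway Q) : P = Q := by
  refine Subtype.ext (Place.eq_of_same_sign fun x => ?_)
  obtain ⟨p, hpx, i, hi⟩ := hF.exists_relation ht x
  set φ := (aeval (h : F) : K[X] →ₐ[K] F).toRingHom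
  have hφ : ∀ q, φ q = aeval (h : F) q := fun _ => rfl
  have hφA : ∀ q, φ q ∈ regularAway Pinf := fun q => aeval_mem_of_mem h.2 q
  -- Horner tails b_j = ∑_{n ≥ j} p_n(h) x^(n-j). All b_j and b_{j+1} x turn out to be regular away
  -- from P_∞, even where x has a pole. Thus x is a quotient of regular functions in ways that
  -- reveal the sign of its valuation.
  let b : ℕ → F := fun j => (divX^[j] p).eval₂ φ x
  have hcoeff : ∀ j n, (divX^[j] p).coeff n = p.coeff (n + j) := fun j => by
    induction j with
    | zero => simp
    | succ j ih => intro n; rw [Function.iterate_succ_apply', coeff_divX, ih]; congr 1; omega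
  have hb : ∀ j, b (j + 1) * x + φ (p.coeff j) = b j := fun j => by
    have := congrArg (eval₂ φ x) (divX_mul_X_add (divX^[j] p))
    rw [eval₂_add, eval₂_mul, eval₂_X, eval₂_C, ← Function.iterate_succ_apply' divX, hcoeff,
      zero_add] at this
    exact this
  have hb0 : b 0 = 0 := hpx
  -- Where x is regular, b_j is a polynomial in regular functions. At a pole of x, induct from b_0 =
  -- 0: b_{j+1} x = b_j - p_j(h) is regular, hence so is b_{j+1}.
  have hbA : ∀ j, b j ∈ regularAway Pinf := fun j => mem_regularAway.mpr fun R hR => by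
    rcases le_or_gt 0 (R.v x) with hx | hx
    · change 0 ≤ R.v (eval₂ φ x _)
      rw [eval₂_eq_sum_range]
      refine R.v.map_le_sum fun l _ => ?_
      rw [R.v.map_mul, R.v.map_pow]
      exact add_nonneg (mem_regularAway.mp (hφA _) R hR) (nsmul_nonneg hx _)
    · induction j with
      | zero => simp [hb0]
      | succ j ih =>
        have hmul : b (j + 1) * x = b j - φ (p.coeff j) := eq_sub_of_add_eq (hb j)
        have hnn : 0 ≤ R.v (b (j + 1) * x) := by
          rw [hmul]
          exact R.v.map_le_sub ih (mem_regularAway.mp (hφA _) R hR)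
        rw [R.v.map_mul] at hnn
        by_contra! hneg
        exact absurd hnn (not_le.mpr (lt_of_le_of_lt (add_le_of_nonpos_left hneg.le) hx))
  have hbxA : ∀ j, b (j + 1) * x ∈ regularAway Pinf := fun j => by
    rw [eq_sub_of_add_eq (hb j)]; exact sub_mem (hbA j) (hφA _)
  -- Since h(P) = 0, the value of p_i(h) at P is the constant coefficient of p_i. So b_i and b_{i+1}
  -- x cannot both vanish at P; as the evaluations agree, whichever is nonzero at P is nonzero at Q
  -- as well.
  have hval : evalAway P ⟨φ (p.coeff i), hφA _⟩ ≠ 0 := by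
    have h1 : (⟨φ (p.coeff i), hφA _⟩ : regularAway Pinf) = aeval h (p.coeff i) :=
      Subtype.ext (aeval_algHom_apply (regularAway Pinf).val h (p.coeff i))
    rw [h1, ← aeval_algHom_apply, hP]
    rwa [coe_aeval_eq_eval, ← coeff_zero_eq_eval_zero]
  have hsplit : (⟨φ (p.coeff i), hφA _⟩ : regularAway Pinf) =
      ⟨b i, hbA i⟩ - ⟨b (i + 1) * x, hbxA i⟩ := Subtype.ext (eq_sub_of_add_eq' (hb i))
  rw [hsplit, map_sub] at hval
  by_cases hbi : evalAway P ⟨b i, hbA i⟩ = 0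
  · right
    have hbx : evalAway P ⟨b (i + 1) * x, hbxA i⟩ ≠ 0 := fun h0 => hval (by rw [hbi, h0, sub_zero])
    have aux : ∀ R : RationalPlacesAway Pinf, evalAway R ⟨b (i + 1) * x, hbxA i⟩ ≠ 0 →
        R.1.v x ≤ 0 := fun R hR => by
      have h0 : R.1.v (b (i + 1) * x) = 0 := v_eq_zero_of_evalAway_ne_zero hR
      rw [R.1.v.map_mul] at h0
      rw [← h0]
      exact le_add_of_nonneg_left (mem_regularAway.mp (hbA _) _ R.2.2)
    exact ⟨aux P hbx, aux Q (heq ▸ hbx)⟩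
  · left
    obtain ⟨j, rfl⟩ : ∃ j, i = j + 1 := Nat.exists_eq_succ_of_ne_zero fun h0 => hbi (by
      subst h0
      rw [← map_zero (evalAway P)]
      exact congrArg _ (Subtype.ext hb0))
    have aux : ∀ R : RationalPlacesAway Pinf, evalAway R ⟨b (j + 1), hbA _⟩ ≠ 0 →
        0 ≤ R.1.v x := fun R hR => by
      have h0 : R.1.v (b (j + 1)) = 0 := v_eq_zero_of_evalAway_ne_zero hR
      have := mem_regularAway.mp (hbxA j) _ R.2.2
      rwa [R.1.v.map_mul, h0, zero_add] at this
    exact ⟨aux P hbi, aux Q (heq ▸ hbi)⟩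

/-! ### Counting rational zeros by the pole order -/

/-- A linear form on the functions regular away from `Pinf` which kills the multiples of `h` is
determined by one function of minimal pole order for each residue class modulo the pole order
of `h`. -/
theorem IsFunctionField.exists_spanning_mod (hF : IsFunctionField K F) {Pinf : Place K F}
    (hPinf : Pinf.IsRational) (h : regularAway Pinf) {N : ℕ} (hN : 0 < N)
    (hv : Pinf.v (h : F) = ((-(N : ℤ) : ℤ) : WithTop ℤ)) :
    ∃ e : Fin N → regularAway Pinf, ∀ ψ : regularAway Pinf →ₗ[K] K,
      (∀ c, ψ (e c) = 0) → (∀ a, ψ (a * h) = 0) → ψ = 0 := by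
  classical
  have hh0 := Pinf.ne_zero_of_v_eq hv
  let E : ℕ → ℕ → Prop := fun c m => m % N = c ∧
    ∃ a : regularAway Pinf, (a : F) ≠ 0 ∧ Pinf.ord (a : F) = -(m : ℤ)
  -- The minimal pole order in the class of c is taken; if the class contains no pole order, 0
  -- serves as a harmless filler.
  have hE : ∀ c, ∃ e : regularAway Pinf, ∀ n, E c n →
      ∃ m ≤ n, m % N = c ∧ (e : F) ≠ 0 ∧ Pinf.ord (e : F) = -(m : ℤ) := fun c => by
    by_cases hc : ∃ m, E c m
    · obtain ⟨h1, e, h2, h3⟩ := Nat.find_spec hc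
      exact ⟨e, fun n hn => ⟨Nat.find hc, Nat.find_min' hc hn, h1, h2, h3⟩⟩
    · exact ⟨0, fun n hn => absurd ⟨n, hn⟩ hc⟩
  choose e he using hE
  refine ⟨fun c => e c, fun ψ hψe hψh => ?_⟩
  have key : ∀ n : ℕ, ∀ a : regularAway Pinf, (a : F) ≠ 0 → Pinf.ord (a : F) = -(n : ℤ) →
      ψ a = 0 := by
    intro n
    induction n using Nat.strong_induction_on with
    | _ n ih =>
      intro a ha0 ha
      obtain ⟨m, hmn, hmod, he0, hem⟩ := he (n % N) n ⟨rfl, a, ha0, ha⟩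
      obtain ⟨t, ht⟩ : ∃ t, n = m + t * N := by
        obtain ⟨t, ht⟩ := (Nat.modEq_iff_dvd' hmn).mp hmod
        exact ⟨t, by rw [mul_comm, ← ht]; omega⟩
      set a' : regularAway Pinf := e (n % N) * h ^ t with ha'
      have ha'0 : (a' : F) ≠ 0 := mul_ne_zero he0 (pow_ne_zero _ hh0)
      have ha'n : Pinf.ord (a' : F) = -(n : ℤ) := by
        change Pinf.ord ((e (n % N) : F) * (h : F) ^ t) = _
        rw [Pinf.ord_mul he0 (pow_ne_zero _ hh0), Pinf.ord_pow hh0, hem, Pinf.ord_eq hv, ht]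
        push_cast; ring
      have hψa' : ψ a' = 0 := by
        rcases t with _ | t
        · rw [ha', pow_zero, mul_one]
          exact hψe ⟨n % N, Nat.mod_lt _ hN⟩
        · rw [ha', pow_succ, ← mul_assoc]
          exact hψh _
      have hq0 : (a : F) * (a' : F)⁻¹ ≠ 0 := mul_ne_zero ha0 (inv_ne_zero ha'0)
      -- The function a' = e h^t has the same pole order as a, so a/a' has a residue c in K, and a -
      -- c a' has a smaller pole order or is zero.
      obtain ⟨c, hc⟩ := hPinf.exists_sub_pos (x := (a : F) * (a' : F)⁻¹) (by
        rw [← Pinf.zero_le_ord_iff hq0, Pinf.ord_mul ha0 (inv_ne_zero ha'0), Pinf.ord_inv ha'0,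
          ha, ha'n]
        omega)
      have hsub : ψ (a - c • a') = 0 := by
        by_cases hz : a - c • a' = 0
        · rw [hz, map_zero]
        have hz' : ((a - c • a' : regularAway Pinf) : F) ≠ 0 := fun h0 => hz (Subtype.ext h0)
        have hfac : ((a - c • a' : regularAway Pinf) : F) =
            ((a : F) * (a' : F)⁻¹ - algebraMap K F c) * (a' : F) := by
          change (a : F) - c • (a' : F) = _
          rw [sub_mul, inv_mul_cancel_right₀ ha'0, Algebra.smul_def]
        have hd0 : (a : F) * (a' : F)⁻¹ - algebraMap K F c ≠ 0 := by
          intro h0; rw [h0, zero_mul] at hfac; exact hz' hfac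
        have hlt : -(n : ℤ) < Pinf.ord ((a - c • a' : regularAway Pinf) : F) := by
          rw [hfac, Pinf.ord_mul hd0 ha'0, ha'n]
          have := (Pinf.ord_pos_iff hd0).mpr hc
          omega
        have hle := hF.ord_nonpos (a - c • a').2 hz'
        exact ih (-Pinf.ord ((a - c • a' : regularAway Pinf) : F)).toNat (by omega) _ hz' (by omega)
      rw [map_sub, map_smul, hψa', smul_zero, sub_zero] at hsub
      exact hsub
  refine LinearMap.ext fun a => ?_
  by_cases ha : a = 0
  · rw [ha, map_zero]; rfl
  have ha' : (a : F) ≠ 0 := by simpa using ha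
  have hle := hF.ord_nonpos a.2 ha'
  exact key (-Pinf.ord (a : F)).toNat a ha' (by omega)

/-- A function whose only pole is at the rational place `Pinf` has at most as many rational zeros
as the order of this pole. -/
theorem IsFunctionField.finite_zeros (hF : IsFunctionField K F) {Pinf : Place K F}
    (hPinf : Pinf.IsRational) (h : regularAway Pinf) {N : ℕ}
    (hv : Pinf.v (h : F) = ((-(N : ℤ) : ℤ) : WithTop ℤ)) :
    {P : RationalPlacesAway Pinf | evalAway P h = 0}.Finite ∧
      {P : RationalPlacesAway Pinf | evalAway P h = 0}.ncard ≤ N := by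
  set Z := {P : RationalPlacesAway Pinf | evalAway P h = 0} with hZ
  rcases Z.eq_empty_or_nonempty with h0 | ⟨P₀, hP₀⟩
  · simp [h0]
  have hh0 := Pinf.ne_zero_of_v_eq hv
  have ht : Transcendental K (h : F) :=
    P₀.1.transcendental_of_pos hh0 ((evalAway_eq_zero_iff P₀ h).mp hP₀)
  have hN : 0 < N := by
    have := hF.v_neg_of_transcendental h.2 ht
    rw [hv] at this
    have h1 : -(N : ℤ) < 0 := by exact_mod_cast this
    omega
  obtain ⟨e, he⟩ := hF.exists_spanning_mod hPinf h hN hv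
  have hli : LinearIndependent K (fun P : Z => (evalAway P.1 : regularAway Pinf → K)) := by
    refine (linearIndependent_monoidHom (regularAway Pinf) K).comp
      (fun P : Z => (evalAway P.1 : regularAway Pinf →* K)) fun P Q hPQ => ?_
    refine Subtype.ext (hF.evalAway_injOn h ht P.2 (AlgHom.ext fun a => ?_))
    exact DFunLike.congr_fun hPQ a
  -- A relation between the values at the N functions `e c` gives a linear form vanishing on them
  -- and on multiples of h, hence everywhere. So the zeros embed as independent vectors of K^N.
  have hli' : LinearIndependent K (fun P : Z => fun c => evalAway P.1 (e c)) := by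
    rw [linearIndependent_iff'] at hli ⊢
    intro s g hg
    refine hli s g ?_
    have hψ := he (∑ P ∈ s, g P • (evalAway P.1).toLinearMap)
      (fun c => by simpa using congrFun hg c) fun a => by
        simp only [LinearMap.sum_apply, LinearMap.smul_apply, AlgHom.toLinearMap_apply, map_mul]
        refine Finset.sum_eq_zero fun P _ => ?_
        rw [show evalAway P.1 h = 0 from P.2, mul_zero, smul_zero]
    funext a
    simpa using LinearMap.congr_fun hψ a
  have hfin : Finite Z := hli'.finite
  refine ⟨Set.toFinite Z, ?_⟩
  have := Fintype.ofFinite Z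
  have hcard := hli'.fintype_card_le_finrank
  rwa [Module.finrank_fin_fun, ← Nat.card_eq_fintype_card, Nat.card_coe_set_eq] at hcard

/-! ### Echelon form and the pole order of the determinant -/

/-- A matrix of full column rank can be brought into column echelon form: the columns of `M * U`
have their last nonzero entries in different rows. -/
theorem _root_.Matrix.exists_mul_strictMono_last_nonzero {K : Type*} [Field K] {k r : ℕ}
    (M : Matrix (Fin k) (Fin r) K) (hM : M.rank = r) :
    ∃ (U : Matrix (Fin r) (Fin r) K) (j : Fin r → Fin k), StrictMono j ∧
      ∀ s, (M * U) (j s) s ≠ 0 ∧ ∀ l, j s < l → (M * U) l s = 0 := by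
  classical
  let Q : Fin k → (Fin r → K) → Prop := fun l u =>
    (M.mulVec u) l ≠ 0 ∧ ∀ l', l < l' → (M.mulVec u) l' = 0
  let J : Finset (Fin k) := Finset.univ.filter fun l => ∃ u, Q l u
  -- J collects the positions of last nonzero entries of vectors in the column space. A nonzero such
  -- vector is nonzero at its own position in J, so restriction to J is injective and |J| is at
  -- least the rank.
  have hJ : r ≤ J.card := by
    let ρ : LinearMap.range M.mulVecLin →ₗ[K] (J → K) :=
      (LinearMap.funLeft K K ((↑) : J → Fin k)).comp (LinearMap.range M.mulVecLin).subtype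
    have hρ : Function.Injective ρ := by
      rw [← LinearMap.ker_eq_bot, LinearMap.ker_eq_bot']
      rintro ⟨_, u, rfl⟩ hu
      by_contra hne
      have hne' : ∃ l, (M.mulVec u) l ≠ 0 := by
        by_contra! h
        exact hne (Subtype.ext (funext h))
      let T : Finset (Fin k) := Finset.univ.filter fun l => (M.mulVec u) l ≠ 0
      obtain ⟨l, hl, hmax⟩ := T.exists_max_image id
        (by obtain ⟨l, hl⟩ := hne'; exact ⟨l, by simpa [T] using hl⟩)
      have hQ : Q l u := ⟨by simpa [T] using hl, fun l' hl' => by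
        by_contra h
        exact absurd (hmax l' (by simpa [T] using h)) (not_le.mpr hl')⟩
      exact hQ.1 (congrFun hu ⟨l, by simpa [J] using ⟨u, hQ⟩⟩)
    have := LinearMap.finrank_le_finrank_of_injective hρ
    rwa [Module.finrank_fintype_fun_eq_card, Fintype.card_coe, ← Matrix.rank, hM] at this
  obtain ⟨J', hJ', hcard⟩ := Finset.exists_subset_card_eq hJ
  have hmem : ∀ s, ∃ u, Q (J'.orderEmbOfFin hcard s) u := fun s => by
    have := hJ' (J'.orderEmbOfFin_mem hcard s)
    simpa [J] using this
  choose u hu using hmem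
  exact ⟨Matrix.of fun l s => u s l, J'.orderEmbOfFin hcard,
    (J'.orderEmbOfFin hcard).strictMono, hu⟩

/-- The r - i indices from i on have distinct images, all in the interval from `j i` to k - 1. -/
theorem _root_.Fin.add_sub_le_of_strictMono {r k : ℕ} {j : Fin r → Fin k} (hj : StrictMono j)
    (i : Fin r) : (j i : ℕ) + (r - i) ≤ k := by
  have := Finset.card_le_card_of_injOn (s := Finset.Ici i) (t := Finset.Ici (j i)) j
    (fun x hx => by
      simp only [Finset.coe_Ici, Set.mem_Ici] at hx ⊢
      exact hj.monotone hx) hj.injective.injOn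
  rw [Fin.card_Ici, Fin.card_Ici] at this
  omega

theorem sum_poleOrder_le {r k : ℕ} (g : ℕ) {j : Fin r → Fin k} (hj : StrictMono j) (hrk : r ≤ k) :
    ((∑ i : Fin r, poleOrder g i (j i) : ℕ) : ℚ) ≤
      (r : ℚ) * (((r : ℚ) + 1) * (3 * (k : ℚ) - (r : ℚ) - 2) / 6 + 2 * (g : ℚ)) := by
  obtain ⟨m, rfl⟩ := Nat.exists_eq_add_of_le' hrk
  have h1 : ∑ i : Fin r, poleOrder g i (j i) ≤
      ∑ i ∈ Finset.range r, ((i + 1) * (m + i) + 2 * g) := by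
    rw [← Fin.sum_univ_eq_sum_range fun i => (i + 1) * (m + i) + 2 * g]
    refine Finset.sum_le_sum fun i _ => ?_
    have := Fin.add_sub_le_of_strictMono hj i
    rw [poleOrder]
    gcongr
    omega
  -- With m = k - r fixed, the closed form holds for every number n of rows if k is replaced by m +
  -- n; this allows induction on n.
  have h2 : ∀ n : ℕ, ((∑ i ∈ Finset.range n, ((i + 1) * (m + i) + 2 * g) : ℕ) : ℚ) =
      (n : ℚ) * (((n : ℚ) + 1) * (3 * ((m + n : ℕ) : ℚ) - (n : ℚ) - 2) / 6 + 2 * (g : ℚ)) := by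
    intro n
    induction n with
    | zero => simp
    | succ n ih =>
      rw [Finset.sum_range_succ, Nat.cast_add, ih]
      push_cast
      ring
  rw [← h2 r]
  exact_mod_cast h1

theorem Place.v_prod (P : Place K F) {ι : Type*} (s : Finset ι) (f : ι → F) (n : ι → ℤ)
    (h : ∀ i ∈ s, P.v (f i) = n i) : P.v (∏ i ∈ s, f i) = ((∑ i ∈ s, n i : ℤ) : WithTop ℤ) := by
  classical
  induction s using Finset.induction_on with
  | empty => simp
  | insert a s ha ih =>
    rw [Finset.prod_insert ha, Finset.sum_insert ha, P.v.map_mul, WithTop.coe_add,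
      h a (Finset.mem_insert_self a s), ih fun i hi => h i (Finset.mem_insert_of_mem hi)]

/-- If the pole orders of the entries are `a i * b j + c` with `a` and `b` strictly increasing,
then the diagonal dominates the expansion of the determinant. -/
theorem Place.v_det_eq (P : Place K F) {r : ℕ} (G : Matrix (Fin r) (Fin r) F) {a b : Fin r → ℤ}
    (ha : StrictMono a) (hb : StrictMono b) (c : ℤ)
    (hG : ∀ i s, P.v (G i s) = ((-(a i * b s + c) : ℤ) : WithTop ℤ)) :
    P.v G.det = ((-∑ i, (a i * b i + c) : ℤ) : WithTop ℤ) := by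
  have hterm : ∀ σ : Equiv.Perm (Fin r), P.v (Equiv.Perm.sign σ • ∏ i, G (σ i) i) =
      ((-∑ i, (a (σ i) * b i + c) : ℤ) : WithTop ℤ) := fun σ => by
    have h := P.v_prod Finset.univ (fun i => G (σ i) i) _ fun i _ => hG (σ i) i
    rw [Finset.sum_neg_distrib] at h
    rcases Int.units_eq_one_or (Equiv.Perm.sign σ) with hs | hs
    · rw [hs, one_smul, h]
    · rw [hs, Units.neg_smul, one_smul, P.v.map_neg, h]
  rw [Matrix.det_apply, ← Finset.add_sum_erase _ _ (Finset.mem_univ 1)]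
  have h1 := hterm 1
  simp only [Equiv.Perm.one_apply] at h1
  rw [P.v.map_add_eq_of_lt_left]
  · simpa only [Equiv.Perm.one_apply] using h1
  · simp only [Equiv.Perm.one_apply]
    rw [h1]
    refine P.v.map_lt_sum WithTop.coe_ne_top fun σ hσ => ?_
    rw [hterm σ, WithTop.coe_lt_coe, neg_lt_neg_iff, Finset.sum_add_distrib,
      Finset.sum_add_distrib, add_lt_add_iff_right]
    -- The rearrangement inequality is strict unless σ is monotone, and the only monotone
    -- permutation of `Fin r` is the identity.
    have hmv : Monovary a b := ha.monotone.monovary hb.monotone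
    refine hmv.sum_comp_perm_mul_lt_sum_mul_iff.mpr fun hcomp => Finset.ne_of_mem_erase hσ ?_
    have hmono : Monotone σ := fun x y hxy => by
      rcases hxy.eq_or_lt with rfl | hlt
      · exact le_rfl
      · exact ha.le_iff_le.mp (hcomp (hb hlt))
    have hsm : StrictMono σ := hmono.strictMono_of_injective σ.injective
    exact Equiv.ext fun x => congrFun (hsm.range_inj strictMono_id |>.mp (by simp)) x

/-- The term at the last nonzero entry of the column has strictly the largest pole order, because
`n` increases. -/
theorem Place.v_mul_matrix_eq (P : Place K F) {r k : ℕ} (f : Matrix (Fin r) (Fin k) F)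
    (B : Matrix (Fin k) (Fin r) K) {n : Fin k → ℤ} (hn : StrictMono n) (i : Fin r) (s : Fin r)
    (hf : ∀ l, P.v (f i l) = ((-n l : ℤ) : WithTop ℤ)) {j : Fin k} (hj : B j s ≠ 0)
    (hB : ∀ l, j < l → B l s = 0) :
    P.v ((f * B.map (algebraMap K F)) i s) = ((-n j : ℤ) : WithTop ℤ) := by
  rw [Matrix.mul_apply, ← Finset.add_sum_erase _ _ (Finset.mem_univ j)]
  have h1 : P.v (f i j * B.map (algebraMap K F) j s) = ((-n j : ℤ) : WithTop ℤ) := by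
    rw [P.v.map_mul, hf, Matrix.map_apply, P.trivial_on _ hj, add_zero]
  rw [P.v.map_add_eq_of_lt_left, h1]
  rw [h1]
  refine P.v.map_lt_sum WithTop.coe_ne_top fun l hl => ?_
  rw [Matrix.map_apply]
  rcases lt_or_gt_of_ne (Finset.ne_of_mem_erase hl) with hlj | hlj
  · rw [P.v.map_mul, hf]
    refine lt_of_lt_of_le ?_ (le_add_of_nonneg_right (P.v_algebraMap_nonneg _))
    exact WithTop.coe_lt_coe.mpr (neg_lt_neg (hn hlj))
  · rw [hB l hlj, map_zero, mul_zero, P.v.map_zero]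
    exact WithTop.coe_lt_top _

/-- For `f` with pole orders `d_{ij}` at `P` and `M` of full column rank, the determinant of `f M`
has a pole order `∑ d_{i, j_i}` for some `j_1 < ... < j_r`. -/
theorem Place.exists_v_det_mul_eq (P : Place K F) {r k : ℕ} (g : ℕ) (f : Matrix (Fin r) (Fin k) F)
    (hf : ∀ i j, P.v (f i j) = ((-(poleOrder g i j : ℤ) : ℤ) : WithTop ℤ))
    (M : Matrix (Fin k) (Fin r) K) (hM : M.rank = r) :
    ∃ j : Fin r → Fin k, StrictMono j ∧ P.v (f * M.map (algebraMap K F)).det =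
      ((-((∑ i, poleOrder g i (j i) : ℕ) : ℤ) : ℤ) : WithTop ℤ) := by
  obtain ⟨U, j, hj, hU⟩ := M.exists_mul_strictMono_last_nonzero hM
  refine ⟨j, hj, ?_⟩
  have hdet := P.v_det_eq (f * (M * U).map (algebraMap K F)) (a := fun i => (i : ℤ) + 1)
    (b := fun s => ((j s : ℕ) : ℤ)) (fun x y hxy => by simpa using hxy)
    (fun x y hxy => by simpa using hj hxy) (2 * g) fun i s => by
      rw [P.v_mul_matrix_eq f (M * U) (n := fun l => (poleOrder g i l : ℤ)) (fun x y hxy => by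
        have : (x : ℕ) < y := hxy
        simp only [poleOrder]
        gcongr) i s (hf i) (hU s).1 (hU s).2]
      simp [poleOrder]
  rw [Matrix.map_mul, ← Matrix.mul_assoc, Matrix.det_mul, P.v.map_mul] at hdet
  have hmap : (U.map (algebraMap K F)).det = algebraMap K F U.det :=
    ((algebraMap K F).map_det U).symm
  -- Invertibility of U comes for free: otherwise det(fMU) would be 0, whereas its valuation is
  -- finite.
  have hU0 : U.det ≠ 0 := by
    intro h0
    rw [hmap, h0, map_zero, P.v.map_zero, add_top] at hdet
    exact WithTop.coe_ne_top hdet.symm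
  rw [hmap, P.trivial_on _ hU0, add_zero] at hdet
  rw [hdet]
  simp [poleOrder]

end FunField

/-! ### The bound on the number of bad places -/

theorem theorem3p2 {Fq F : Type*} [Field Fq] [Finite Fq] [Field F] [Algebra Fq F]
    (hF : FunField.IsFunctionField Fq F)
    (Pinf : FunField.Place Fq F) (hPinf : Pinf.IsRational)
    (r k : ℕ) (hr : 1 ≤ r) (hrk : r ≤ k)
    (f : Matrix (Fin r) (Fin k) F)
    (hf : ∀ i j, f i j ∈ FunField.rrSpace
      (Finsupp.single Pinf (FunField.poleOrder (FunField.genus Fq F) i j : ℤ)))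
    (hfv : ∀ i j, Pinf.v (f i j) =
      ((-(FunField.poleOrder (FunField.genus Fq F) i j : ℤ) : ℤ) : WithTop ℤ))
    (M : Matrix (Fin k) (Fin r) Fq) (hM : M.rank = r) :
    {P : FunField.RationalPlacesAway Pinf |
        (FunField.evalMatrix f hf P * M).rank < r}.Finite ∧
      ({P : FunField.RationalPlacesAway Pinf |
        (FunField.evalMatrix f hf P * M).rank < r}.ncard : ℚ) ≤
        (r : ℚ) * (((r : ℚ) + 1) * (3 * (k : ℚ) - (r : ℚ) - 2) / 6
          + 2 * (FunField.genus Fq F : ℚ)) := by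
  have hfA : ∀ i j, f i j ∈ FunField.regularAway Pinf := fun i j =>
    FunField.mem_regularAway.mpr fun P hP => FunField.mem_valuationRing_of_mem_rrSpace hP (hf i j)
  let f' : Matrix (Fin r) (Fin k) (FunField.regularAway Pinf) :=
    Matrix.of fun i j => ⟨f i j, hfA i j⟩
  -- The product fM is formed over the ring of regular functions, so that its determinant can be
  -- evaluated at P as well as valued at P_∞.
  let G : Matrix (Fin r) (Fin r) (FunField.regularAway Pinf) :=
    f' * M.map (algebraMap Fq (FunField.regularAway Pinf))
  obtain ⟨j, hj, hv⟩ := Pinf.exists_v_det_mul_eq _ f hfv M hM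
  have hval : (G.det : F) = (f * M.map (algebraMap Fq F)).det := by
    have := (FunField.regularAway Pinf).val.toRingHom.map_det G
    rw [RingHom.mapMatrix_apply, Matrix.map_mul] at this
    exact this
  have heval : ∀ P : FunField.RationalPlacesAway Pinf,
      FunField.evalAway P G.det = (FunField.evalMatrix f hf P * M).det := fun P => by
    have := (FunField.evalAway P).toRingHom.map_det G
    rw [RingHom.mapMatrix_apply, Matrix.map_mul, Matrix.map_map] at this
    refine this.trans ?_
    congr 2
    ext i j
    exact (FunField.evalAway P).commutes _
  have hsub : {P : FunField.RationalPlacesAway Pinf |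
      (FunField.evalMatrix f hf P * M).rank < r} ⊆ {P | FunField.evalAway P G.det = 0} := by
    intro P hP
    by_contra hne
    have hdet : (FunField.evalMatrix f hf P * M).det ≠ 0 := heval P ▸ hne
    have hrank := Matrix.rank_of_det_ne_zero hdet
    rw [Fintype.card_fin] at hrank
    exact hP.ne hrank
  rw [← hval] at hv
  obtain ⟨hfin, hcard⟩ := hF.finite_zeros hPinf G.det hv
  refine ⟨hfin.subset hsub, le_trans ?_ (FunField.sum_poleOrder_le _ hj hrk)⟩
  exact_mod_cast (Set.ncard_le_ncard hsub hfin).trans hcard
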